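/- Let $N\ge 1$, $\mathbf{x}=(x_1,\dots,x_N)$, and let $F=(f_1,\dots,f_N)\in\mathbb{R}[\mathbf{x}]^N$ be a polynomial vector field. For $\mathbf{x}_0\in\mathbb{R}^N$ let $\mathbf{x}(t;\mathbf{x}_0)$ be the time trajectory, i.e. the solution of $\dot{\mathbf{x}}=F(\mathbf{x})$, $\mathbf{x}(0)=\mathbf{x}_0$, on the largest symmetric open interval $D_{\mathbf{x}_0}$ on which the Taylor expansions from $0$ of all its components converge. For $p\in\mathbb{R}[\mathbf{x}]$ let $p(t;\mathbf{x}_0)$ be the sum of the Taylor expansion from $0$ of $t\mapsto p(\mathbf{x}(t;\mathbf{x}_0))$ on its largest symmetric open interval of convergence; $p$ is a polynomial invariant for $\mathbf{x}_0$ if $p(t;\mathbf{x}_0)$ is identically $0$. Let $\psi\subseteq\mathbb{R}^N$ be an algebraic variety (the set of common zeros of a set of polynomials), and for $A\subseteq\mathbb{R}^N$ let $\mathrm{Id}(A)$ be the ideal of polynomials vanishing on $A$. Let $\phi_\psi$ be the intersection of all algebraic varieties $\phi$ such that $\mathbf{x}(t;\mathbf{x}_0)\in\phi$ for all $\mathbf{x}_0\in\psi$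 and $t\in D_{\mathbf{x}_0}$, and let $I_\psi=\mathrm{Id}(\phi_\psi)$. For $k\ge 0$ let $\pi_k=\sum_{\alpha}a_\alpha\,\alpha$ be the complete template of degree $k$, where $\alpha$ ranges over the monomials in $\mathbf{x}$ of degree $\le k$ and the $a_\alpha$ are $n$ distinct parameters, listed in any order as $a_1,\dots,a_n$. For $v\in\mathbb{R}^n$ and $q\in\mathbb{R}[\mathbf{a},\mathbf{x}]$ let $q[v]\in\mathbb{R}[\mathbf{x}]$ be the result of substituting $v$ for $\mathbf{a}$. Let $\mathcal{L}(q)=\sum_{i=1}^N f_i\,\partial q/\partial x_i$ (the parameters being treated as constants) and $\pi_k^{(j)}=\mathcal{L}^{j}(\pi_k)$. The algorithm $\mathrm{POST}(\psi,\pi_k)$ is as follows. Take a (finite) Gröbner basis $G\subseteq\mathbb{R}[\mathbf{x}]$ of $\mathrm{Id}(\psi)$ for the lexicographic order with $x_1>\dots>x_N$, and let $r_j=\pi_k^{(j)}\bmod G$ be the remainder of multivariate division in $\mathbb{R}[\mathbf{a},\mathbf{x}]$ for the lexicographic order with $a_1>\dots>a_n>x_1>\dots>x_N$. Put $$V_i=\{v\in\mathbb{R}^n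 : r_j[v]=0 \text{ for } j=0,\dots,i\},\qquad J_i=\Big\langle \bigcup_{j=0}^{i}\{\pi_k^{(j)}[v] : v\in V_i\}\Big\rangle .$$ The output is $(V,J)=(V_m,J_m)$, where $m$ is the least integer $\ge 0$ with $V_{m+1}=V_m$ and $J_{m+1}=J_m$. Then $I_\psi$ is exactly the set of all $p\in\mathbb{R}[\mathbf{x}]$ that are polynomial invariants for every $\mathbf{x}_0\in\psi$; and there is $K$ (depending only on $F$ and $\psi$) such that for every $k\ge K$ the algorithm $\mathrm{POST}(\psi,\pi_k)$ has an output, and every output $(V,J)$ (for every choice of the Gröbner basis and of the enumeration of the parameters) satisfies $J=I_\psi$. -/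

import Mathlib

noncomputable section

namespace PolyODE

open MvPolynomial

/-! ### Initial value problems, time trajectories and polynomial behaviours -/

/-- The function `ℝ^N → ℝ^N` induced by a vector of `N` polynomials. -/
def vectorField {N : ℕ} (F : Fin N → MvPolynomial (Fin N) ℝ) (x : Fin N → ℝ) : Fin N → ℝ :=
  fun i => eval x (F i)

/-- `x` solves `x' = F(x)`, `x(0) = x₀` on the open interval `D` containing `0`. -/
def IsSolution {N : ℕ} (F : Fin N → MvPolynomial (Fin N) ℝ) (x₀ : Fin N → ℝ)
    (D : Set ℝ) (x : ℝ → Fin N → ℝ) : Prop :=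
  IsOpen D ∧ D.OrdConnected ∧ 0 ∈ D ∧ x 0 = x₀ ∧
    ∀ t ∈ D, HasDerivAt x (vectorField F (x t)) t

/-- Local existence of solutions, by the Picard-Lindelöf theorem. -/
theorem exists_isSolution {N : ℕ} (F : Fin N → MvPolynomial (Fin N) ℝ) (x₀ : Fin N → ℝ) :
    ∃ x : ℝ → Fin N → ℝ, ∃ D : Set ℝ, IsSolution F x₀ D x := by
  have hF : ContDiff ℝ 1 (vectorField F) :=
    contDiff_pi.2 fun i => contDiff_iff_contDiffAt.2 fun x =>
      (AnalyticOnNhd.eval_mvPolynomial (𝕜 := ℝ) (F i) x (Set.mem_univ x)).contDiffAt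
  obtain ⟨x, hx, ε, hε, h⟩ :=
    hF.contDiffAt.exists_forall_mem_closedBall_exists_eq_forall_mem_Ioo_hasDerivAt₀
      (x₀ := x₀) 0
  exact ⟨x, Set.Ioo (0 - ε) (0 + ε), isOpen_Ioo, Set.ordConnected_Ioo, by simpa using hε, hx, h⟩

/-- A solution of the initial value problem on some open interval containing `0`.  Any two
solutions agree near `0`, and only the values near `0` are used below. -/
def localSolution {N : ℕ} (F : Fin N → MvPolynomial (Fin N) ℝ) (x₀ : Fin N → ℝ) :
    ℝ → Fin N → ℝ :=
  Classical.choose (exists_isSolution F x₀)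

/-- The `j`-th term of the Taylor expansion of `g` from `0`, at `t`. -/
def taylorTerm (g : ℝ → ℝ) (j : ℕ) (t : ℝ) : ℝ :=
  iteratedDeriv j g 0 / (j.factorial : ℝ) * t ^ j

/-- The largest symmetric open interval on which the Taylor expansions from `0` of all the `g i`
converge, that is, the union of all such intervals. -/
def convergenceInterval {ι : Type*} (g : ι → ℝ → ℝ) : Set ℝ :=
  {t | ∃ r : ℝ, |t| < r ∧ ∀ s : ℝ, |s| < r → ∀ i, Summable fun j => taylorTerm (g i) j s}

/-- The domain `D_{x₀}` of the time trajectory. -/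
def trajectoryDomain {N : ℕ} (F : Fin N → MvPolynomial (Fin N) ℝ) (x₀ : Fin N → ℝ) : Set ℝ :=
  convergenceInterval fun (i : Fin N) (s : ℝ) => localSolution F x₀ s i

/-- The time trajectory `x(t; x₀)`, meaningful for `t` in `D_{x₀}`. -/
def trajectory {N : ℕ} (F : Fin N → MvPolynomial (Fin N) ℝ) (x₀ : Fin N → ℝ) (t : ℝ) :
    Fin N → ℝ :=
  fun i => ∑' j, taylorTerm (fun s => localSolution F x₀ s i) j t

/-- The function `t ↦ p(x(t; x₀))` on `D_{x₀}`. -/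
def alongTrajectory {N : ℕ} (F : Fin N → MvPolynomial (Fin N) ℝ) (x₀ : Fin N → ℝ)
    (p : MvPolynomial (Fin N) ℝ) (t : ℝ) : ℝ :=
  eval (trajectory F x₀ t) p

/-- The domain of the polynomial behaviour `p(t; x₀)`. -/
def behaviourDomain {N : ℕ} (F : Fin N → MvPolynomial (Fin N) ℝ) (x₀ : Fin N → ℝ)
    (p : MvPolynomial (Fin N) ℝ) : Set ℝ :=
  convergenceInterval fun _ : Unit => alongTrajectory F x₀ p

/-- The polynomial behaviour `p(t; x₀)`, meaningful for `t` in its domain. -/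
def behaviour {N : ℕ} (F : Fin N → MvPolynomial (Fin N) ℝ) (x₀ : Fin N → ℝ)
    (p : MvPolynomial (Fin N) ℝ) (t : ℝ) : ℝ :=
  ∑' j, taylorTerm (alongTrajectory F x₀ p) j t

/-- `p` is a polynomial invariant for `F` and `x₀`: its behaviour is identically zero. -/
def IsPolynomialInvariant {N : ℕ} (F : Fin N → MvPolynomial (Fin N) ℝ) (x₀ : Fin N → ℝ)
    (p : MvPolynomial (Fin N) ℝ) : Prop :=
  ∀ t ∈ behaviourDomain F x₀ p, behaviour F x₀ p t = 0

/-! ### Varieties, safety assertions and the strongest postcondition -/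

/-- `A` is the set of common zeros of some set of polynomials. -/
def IsAlgebraicVariety {N : ℕ} (A : Set (Fin N → ℝ)) : Prop :=
  ∃ P : Set (MvPolynomial (Fin N) ℝ), A = {x | ∀ p ∈ P, eval x p = 0}

/-- The safety assertion `ψ → [F] φ`. -/
def SafetyAssertion {N : ℕ} (F : Fin N → MvPolynomial (Fin N) ℝ) (ψ φ : Set (Fin N → ℝ)) : Prop :=
  ∀ x₀ ∈ ψ, ∀ t ∈ trajectoryDomain F x₀, trajectory F x₀ t ∈ φ

/-- The strongest algebraic postcondition `φ_ψ`: the intersection of all algebraic varieties `φ`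
such that `ψ → [F] φ`. -/
def strongestPostcondition {N : ℕ} (F : Fin N → MvPolynomial (Fin N) ℝ) (ψ : Set (Fin N → ℝ)) :
    Set (Fin N → ℝ) :=
  ⋂₀ {φ | IsAlgebraicVariety φ ∧ SafetyAssertion F ψ φ}

/-- The ideal `I_ψ`, that is, the ideal of all polynomials vanishing on `φ_ψ`. -/
def strongestPostIdeal {N : ℕ} (F : Fin N → MvPolynomial (Fin N) ℝ) (ψ : Set (Fin N → ℝ)) :
    Ideal (MvPolynomial (Fin N) ℝ) :=
  vanishingIdeal ℝ (strongestPostcondition F ψ)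

/-! ### Multivariate division and Gröbner bases -/

/-- `r` is a remainder of the division of `f` by the finite set `G`: `f = ∑ h_g g + r`, no `h_g g`
has a leading monomial larger than that of `f`, and no monomial of `r` is divisible by the leading
monomial of a nonzero element of `G`. -/
def IsRemainder {σ : Type*} (m : MonomialOrder σ) (G : Finset (MvPolynomial σ ℝ))
    (f r : MvPolynomial σ ℝ) : Prop :=
  ∃ h : MvPolynomial σ ℝ → MvPolynomial σ ℝ,
    f = ∑ g ∈ G, h g * g + r ∧
    (∀ g ∈ G, m.toSyn (m.degree (h g * g)) ≤ m.toSyn (m.degree f)) ∧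
    ∀ c ∈ r.support, ∀ g ∈ G, g ≠ 0 → ¬ m.degree g ≤ c

/-- `G` is a Gröbner basis of `I`: a finite basis of `I` such that a polynomial lies in `I` exactly
when its remainder modulo `G` is zero. -/
def IsGroebnerBasis {σ : Type*} (m : MonomialOrder σ) (G : Finset (MvPolynomial σ ℝ))
    (I : Ideal (MvPolynomial σ ℝ)) : Prop :=
  Ideal.span (G : Set (MvPolynomial σ ℝ)) = I ∧
    ∀ p r : MvPolynomial σ ℝ, IsRemainder m G p r → (p ∈ I ↔ r = 0)

/-! ### Templates

The variables of `ℝ[a, x]` are indexed by the lexicographic sum `Fin n ⊕ₗ Fin N`; the lexicographic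
monomial order on it has `a_1 > ⋯ > a_n > x_1 > ⋯ > x_N`. -/

/-- The polynomial ring `ℝ[a, x]` in parameters `a_1, …, a_n` and variables `x_1, …, x_N`. -/
abbrev ParamPoly (n N : ℕ) : Type := MvPolynomial (Fin n ⊕ₗ Fin N) ℝ

/-- The inclusion of `ℝ[x]` into `ℝ[a, x]`. -/
def inclusion {n N : ℕ} (p : MvPolynomial (Fin N) ℝ) : ParamPoly n N :=
  rename (fun i => toLex (Sum.inr i)) p

/-- `π[v]`: the polynomial in `ℝ[x]` obtained by replacing each parameter `a_i` with `v i`. -/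
def substParams {n N : ℕ} (v : Fin n → ℝ) (π : ParamPoly n N) : MvPolynomial (Fin N) ℝ :=
  aeval (fun s => Sum.elim (fun i => C (v i)) X (ofLex s)) π

/-- The Lie derivative along `F` on `ℝ[a, x]`, with the parameters treated as constants. -/
def lieDeriv {n N : ℕ} (F : Fin N → MvPolynomial (Fin N) ℝ) (π : ParamPoly n N) : ParamPoly n N :=
  ∑ i : Fin N, pderiv (toLex (Sum.inr i)) π * inclusion (F i)

/-- The `j`-th Lie derivative `π^{(j)}`. -/
def iterLie {n N : ℕ} (F : Fin N → MvPolynomial (Fin N) ℝ) (j : ℕ) (π : ParamPoly n N) :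
    ParamPoly n N :=
  (lieDeriv F)^[j] π

/-- The complete template `∑_α a_α α` of degree `k`; the equivalence `e` enumerates the monomials
of degree at most `k` and so names the parameter of each. -/
def completeTemplate {n N k : ℕ} (e : Fin n ≃ {α : Fin N →₀ ℕ // α.degree ≤ k}) : ParamPoly n N :=
  ∑ i : Fin n, X (toLex (Sum.inl i)) * inclusion (monomial (e i : Fin N →₀ ℕ) 1)

/-! ### The double chain algorithm -/

/-- The set `V_i` of parameter valuations determined by the remainders `r_j`. -/
def valuationSet {n N : ℕ} (r : ℕ → ParamPoly n N) (i : ℕ) : Set (Fin n → ℝ) :=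
  {v | ∀ j ≤ i, substParams v (r j) = 0}

/-- The ideal `J_i` generated by all `π^{(j)}[v]` with `j ≤ i` and `v ∈ V_i`. -/
def chainIdeal {n N : ℕ} (F : Fin N → MvPolynomial (Fin N) ℝ) (π : ParamPoly n N)
    (r : ℕ → ParamPoly n N) (i : ℕ) : Ideal (MvPolynomial (Fin N) ℝ) :=
  Ideal.span {q | ∃ j ≤ i, ∃ v ∈ valuationSet r i, q = substParams v (iterLie F j π)}

open Classical in
/-- `POST(ψ, π) = (V, J)`: for a Gröbner basis `G` of `Id(ψ)`, the remainders `r_j` of `π^{(j)}`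
modulo `G` in `ℝ[a, x]`, and the least `m` at which both chains are stationary,
`V = V_m` and `J = J_m`. -/
def Post {n N : ℕ} (F : Fin N → MvPolynomial (Fin N) ℝ) (ψ : Set (Fin N → ℝ))
    (π : ParamPoly n N) (V : Set (Fin n → ℝ)) (J : Ideal (MvPolynomial (Fin N) ℝ)) : Prop :=
  ∃ (G : Finset (MvPolynomial (Fin N) ℝ)) (r : ℕ → ParamPoly n N) (m : ℕ),
    IsGroebnerBasis MonomialOrder.lex G (vanishingIdeal ℝ ψ) ∧
    (∀ j, IsRemainder MonomialOrder.lex (G.image inclusion) (iterLie F j π) (r j)) ∧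
    IsLeast {m | valuationSet r (m + 1) = valuationSet r m ∧
      chainIdeal F π r (m + 1) = chainIdeal F π r m} m ∧
    V = valuationSet r m ∧ J = chainIdeal F π r m

end PolyODE

end

noncomputable section

namespace PolyODE

open MvPolynomial

/-! ### Division and Gröbner bases -/

/-! Let L be the Lie derivative along `F`, let I = Id(ψ), and let I* be the ideal of all p with L^j
p ∈ I for every j (`invariantIdeal`). Both claims reduce to I*.

Analysis: the j-th derivative at 0 of p along the trajectory from x₀ is (L^j p)(x₀)
(`iteratedDeriv_alongTrajectory`). By analyticity, p vanishes along the trajectory, or is an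
invariant for x₀, exactly when all these numbers are 0 (`alongTrajectory_eq_zero_iff`,
`isPolynomialInvariant_iff`). Requiring this for all x₀ ∈ ψ says p ∈ I*, so I_ψ = I*
(`strongestPostIdeal_eq`).

Algebra: r_j[v] = 0 if and only if π^(j)[v] ∈ I (`substParams_remainder_eq_zero_iff`), so V_i
consists of the v with L^j(π[v]) ∈ I for all j ≤ i. When both chains repeat at m, J_m is stable
under L and contained in I, hence in I*. Conversely, I* is finitely generated; once k bounds the
degrees of the generators, each is some π[v] with v in every V_i, so I* ⊆ J_m. Finite dimension and
the Noetherian property make both chains repeat. -/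

theorem exists_isRemainder {σ : Type*} (m : MonomialOrder σ) (G : Finset (MvPolynomial σ ℝ))
    (f : MvPolynomial σ ℝ) : ∃ r, IsRemainder m G f r := by
  classical
  -- Division needs invertible leading coefficients, so a zero element of `G` is left out here and
  -- receives quotient 0 below.
  obtain ⟨h, r, hf, hd, hr⟩ := m.div_set (B := {g | g ∈ G ∧ g ≠ 0})
    (fun g hg => (m.leadingCoeff_ne_zero_iff.2 hg.2).isUnit) f
  refine ⟨r, fun g => if hg : g ∈ G ∧ g ≠ 0 then h ⟨g, hg⟩ else 0, ?_, ?_, ?_⟩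
  · rw [hf, Finsupp.linearCombination_apply, Finsupp.sum]
    congr 1
    refine Finset.sum_bij_ne_zero (fun b _ _ => (b : MvPolynomial σ ℝ)) ?_ ?_ ?_ ?_
    · intro b _ _
      exact b.2.1
    · intro b _ _ b' _ _ hbb
      exact Subtype.ext hbb
    · intro g hg hne
      have hg0 : g ≠ 0 := by
        rintro rfl
        simp at hne
      beta_reduce at hne
      rw [dif_pos (show g ∈ G ∧ g ≠ 0 from ⟨hg, hg0⟩)] at hne
      refine ⟨⟨g, hg, hg0⟩, ?_, ?_, rfl⟩
      · rw [Finsupp.mem_support_iff]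
        intro h0
        simp [h0] at hne
      · simpa using hne
    · intro b _ _
      beta_reduce
      rw [dif_pos (show (b : MvPolynomial σ ℝ) ∈ G ∧ (b : MvPolynomial σ ℝ) ≠ 0 from b.2)]
      rfl
  · intro g hg
    by_cases hg0 : g = 0
    · simp [hg0]
    · dsimp only
      rw [dif_pos ⟨hg, hg0⟩, mul_comm]
      exact hd ⟨g, hg, hg0⟩
  · intro c hc g hg hg0
    exact hr c hc g ⟨hg, hg0⟩

theorem IsRemainder.sub_mem {σ : Type*} {m : MonomialOrder σ} {G : Finset (MvPolynomial σ ℝ)}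
    {f r : MvPolynomial σ ℝ} (h : IsRemainder m G f r) :
    f - r ∈ Ideal.span (G : Set (MvPolynomial σ ℝ)) := by
  obtain ⟨h, hf, -, -⟩ := h
  rw [hf, add_sub_cancel_right]
  exact Ideal.sum_mem _ fun g hg => Ideal.mul_mem_left _ _ (Ideal.subset_span hg)

/-- A polynomial none of whose monomials is reducible is its own remainder. -/
theorem isRemainder_self {σ : Type*} {m : MonomialOrder σ} {G : Finset (MvPolynomial σ ℝ)}
    {r : MvPolynomial σ ℝ} (h : ∀ c ∈ r.support, ∀ g ∈ G, g ≠ 0 → ¬ m.degree g ≤ c) :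
    IsRemainder m G r r :=
  ⟨fun _ => 0, by simp, fun g _ => by simp, h⟩

/-- By Dickson's lemma the leading exponents of `I` have finitely many minimal elements; `G` takes
one polynomial for each. A nonzero remainder of an element of `I` would lie in `I`, so its leading
monomial would be reducible. -/
theorem exists_isGroebnerBasis {σ : Type*} [Finite σ] (m : MonomialOrder σ)
    (I : Ideal (MvPolynomial σ ℝ)) : ∃ G, IsGroebnerBasis m G I := by
  classical
  set S : Set (σ →₀ ℕ) := {d | ∃ p ∈ I, p ≠ 0 ∧ m.degree p = d} with hS
  have hfin : {d | Minimal (· ∈ S) d}.Finite :=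
    WellQuasiOrderedLE.finite_of_isAntichain (setOfPred_minimal_antichain _)
  have hex : ∀ d : σ →₀ ℕ, ∃ p ∈ I, d ∈ S → p ≠ 0 ∧ m.degree p = d := by
    intro d
    by_cases hd : d ∈ S
    · obtain ⟨p, hp, h⟩ := hd
      exact ⟨p, hp, fun _ => h⟩
    · exact ⟨0, I.zero_mem, fun h => (hd h).elim⟩
  choose b hbI hb using hex
  set G := hfin.toFinset.image b with hG
  have hGI : ∀ g ∈ G, g ∈ I := by
    intro g hg
    obtain ⟨d, -, rfl⟩ := Finset.mem_image.1 hg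
    exact hbI d
  have hspan : Ideal.span (G : Set (MvPolynomial σ ℝ)) ≤ I := Ideal.span_le.2 hGI
  have hzero : ∀ p r, IsRemainder m G p r → p ∈ I → r = 0 := by
    intro p r hr hp
    have hrI : r ∈ I := by simpa using I.sub_mem hp (hspan hr.sub_mem)
    by_contra hr0
    obtain ⟨d, hd, hdm⟩ := exists_minimal_le_of_wellFoundedLT (· ∈ S) (m.degree r)
      ⟨r, hrI, hr0, rfl⟩
    obtain ⟨hb0, hbd⟩ := hb d hdm.prop
    obtain ⟨-, -, -, h⟩ := hr
    refine h _ (m.degree_mem_support hr0) (b d) ?_ hb0 (hbd.symm ▸ hd)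
    exact Finset.mem_image_of_mem _ (hfin.mem_toFinset.2 hdm)
  refine ⟨G, le_antisymm hspan fun p hp => ?_, fun p r hr => ⟨hzero p r hr, ?_⟩⟩
  · obtain ⟨r, hr⟩ := exists_isRemainder m G p
    simpa [hzero p r hr hp] using hr.sub_mem
  · rintro rfl
    simpa using hspan hr.sub_mem

/-! ### Specialization of the parameters -/

section Specialization

variable {n N : ℕ}

theorem inclusion_injective : Function.Injective (inclusion (n := n) (N := N)) :=
  rename_injective _ fun i j h => by simpa using h

@[simp]
theorem substParams_inclusion (v : Fin n → ℝ) (p : MvPolynomial (Fin N) ℝ) :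
    substParams v (inclusion p) = p := by
  simp only [substParams, inclusion, aeval_rename]
  exact aeval_X_left_apply p

/-- Both images have exponent 0 at every parameter, so the first difference occurs among the
variables x. -/
theorem toLex_mapDomain_inr_le {α β : Fin N →₀ ℕ} (h : toLex α ≤ toLex β) :
    toLex (α.mapDomain fun i => (toLex (Sum.inr i) : Fin n ⊕ₗ Fin N)) ≤
      toLex (β.mapDomain fun i => (toLex (Sum.inr i) : Fin n ⊕ₗ Fin N)) := by
  have hinj : Function.Injective fun i : Fin N => (toLex (Sum.inr i) : Fin n ⊕ₗ Fin N) :=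
    fun i j h => by simpa using h
  rcases h.eq_or_lt with h | h
  · rw [toLex.injective h]
  · obtain ⟨i, hlt, hi⟩ := h
    refine le_of_lt ⟨toLex (Sum.inr i), ?_, ?_⟩
    · intro s hs
      obtain ⟨s, rfl⟩ := toLex.surjective s
      rcases s with a | j
      · simp only [ofLex_toLex]
        rw [Finsupp.mapDomain_of_notMem_range, Finsupp.mapDomain_of_notMem_range] <;> simp
      · have hji : j < i := by simpa using hs
        simpa only [ofLex_toLex, Finsupp.mapDomain_apply hinj] using hlt j hji
    · simpa only [ofLex_toLex, Finsupp.mapDomain_apply hinj] using hi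

theorem degree_inclusion {g : MvPolynomial (Fin N) ℝ} (hg : g ≠ 0) :
    MonomialOrder.lex.degree (inclusion (n := n) g) =
      (MonomialOrder.lex.degree g).mapDomain fun i => toLex (Sum.inr i) := by
  classical
  have hinj : Function.Injective fun i : Fin N => (toLex (Sum.inr i) : Fin n ⊕ₗ Fin N) :=
    fun i j h => by simpa using h
  have hsupp := support_rename_of_injective (p := g) hinj
  apply MonomialOrder.lex.toSyn.injective
  apply le_antisymm
  · rw [MonomialOrder.degree_le_iff]
    intro c hc
    rw [inclusion, hsupp] at hc
    obtain ⟨α, hα, rfl⟩ := Finset.mem_image.1 hc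
    exact toLex_mapDomain_inr_le (MonomialOrder.lex.le_degree hα)
  · apply MonomialOrder.le_degree
    rw [inclusion, hsupp]
    exact Finset.mem_image_of_mem _ (MonomialOrder.lex.degree_mem_support hg)

/-- Specialization sends a monomial `a^β x^α` to a multiple of `x^α`. -/
theorem exists_of_mem_support_substParams (v : Fin n → ℝ) (r : ParamPoly n N) {α : Fin N →₀ ℕ}
    (hα : α ∈ (substParams v r).support) :
    ∃ c ∈ r.support, α = c.comapDomain (fun i => toLex (Sum.inr i))
      (fun i _ j _ h => by simpa using h) := by
  classical
  rw [r.as_sum, substParams, map_sum] at hα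
  obtain ⟨c, hc, hαc⟩ := Finset.mem_biUnion.1 (support_sum hα)
  refine ⟨c, hc, ?_⟩
  rw [aeval_monomial] at hαc
  have key : (c.prod fun s e => (Sum.elim (fun i => C (v i)) X (ofLex s) :
      MvPolynomial (Fin N) ℝ) ^ e) =
      C (∏ i : Fin n, v i ^ c (toLex (Sum.inl i))) *
        monomial (c.comapDomain (fun i => toLex (Sum.inr i))
          (fun i _ j _ h => by simpa using h)) 1 := by
    rw [Finsupp.prod_fintype _ _ (by simp), monomial_eq,
      Finsupp.prod_fintype _ _ (by simp)]
    rw [← (toLex : Fin n ⊕ Fin N ≃ _).prod_comp, Fintype.prod_sum_type]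
    simp only [ofLex_toLex, Sum.elim_inl, Sum.elim_inr, map_prod, map_pow, map_one, one_mul]
    rfl
  rw [key, ← mul_assoc] at hαc
  simp only [algebraMap_eq, ← C_mul, C_mul_monomial] at hαc
  exact Finset.mem_singleton.1 (support_monomial_subset hαc)

-- Leading monomials of elements of `G` involve only x, so reducibility of a^β x^α depends on α
-- alone. Specialization therefore keeps `r` reduced: `substParams v r` is its own remainder, and
-- the Gröbner property applies to it.
open Classical in
theorem substParams_remainder_eq_zero_iff {I : Ideal (MvPolynomial (Fin N) ℝ)}
    {G : Finset (MvPolynomial (Fin N) ℝ)} (hG : IsGroebnerBasis MonomialOrder.lex G I)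
    {f r : ParamPoly n N} (hr : IsRemainder MonomialOrder.lex (G.image inclusion) f r)
    (v : Fin n → ℝ) : substParams v r = 0 ↔ substParams v f ∈ I := by
  have hself : IsRemainder MonomialOrder.lex G (substParams v r) (substParams v r) := by
    refine isRemainder_self fun α hα g hg hg0 hle => ?_
    obtain ⟨c, hc, rfl⟩ := exists_of_mem_support_substParams v r hα
    obtain ⟨-, -, -, h⟩ := hr
    refine h c hc (inclusion g) (Finset.mem_image_of_mem _ hg) ?_ ?_
    · intro h0
      exact hg0 (inclusion_injective (h0.trans (by simp [inclusion])))
    · rw [degree_inclusion hg0]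
      intro s
      obtain ⟨s, rfl⟩ := toLex.surjective s
      rcases s with a | j
      · rw [Finsupp.mapDomain_of_notMem_range] <;> simp
      · rw [Finsupp.mapDomain_apply (fun i j h => by simpa using h)]
        exact hle j
  have hsub : substParams v f - substParams v r ∈ I := by
    obtain ⟨h, hf, -, -⟩ := hr
    rw [hf]
    simp only [substParams, map_add, map_sum, add_sub_cancel_right, map_mul]
    refine I.sum_mem fun g hg => I.mul_mem_left _ ?_
    obtain ⟨g, hg', rfl⟩ := Finset.mem_image.1 hg
    have := substParams_inclusion v g
    rw [substParams] at this
    rw [this, ← hG.1]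
    exact Ideal.subset_span hg'
  rw [← hG.2 _ _ hself]
  exact ⟨fun h => by simpa using I.add_mem hsub h, fun h => by simpa using I.sub_mem h hsub⟩

/-- The Lie derivative along `F` on `ℝ[x]`. -/
def lieDerivation (F : Fin N → MvPolynomial (Fin N) ℝ) :
    Derivation ℝ (MvPolynomial (Fin N) ℝ) (MvPolynomial (Fin N) ℝ) :=
  mkDerivation ℝ F

/-- Both sides are additive and obey the Leibniz rule over the specialization homomorphism, so it
suffices to compare them on generators; a parameter gives 0 on both sides. -/
theorem substParams_lieDeriv (F : Fin N → MvPolynomial (Fin N) ℝ) (v : Fin n → ℝ)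
    (π : ParamPoly n N) : substParams v (lieDeriv F π) = lieDerivation F (substParams v π) := by
  have hadd : ∀ p q : ParamPoly n N, lieDeriv F (p + q) = lieDeriv F p + lieDeriv F q := by
    intro p q
    simp [lieDeriv, add_mul, Finset.sum_add_distrib]
  have hmul : ∀ p q : ParamPoly n N, lieDeriv F (p * q) = lieDeriv F p * q + p * lieDeriv F q := by
    intro p q
    simp only [lieDeriv, pderiv_mul, Finset.sum_mul, Finset.mul_sum, ← Finset.sum_add_distrib]
    exact Finset.sum_congr rfl fun i _ => by ring
  have sadd : ∀ p q : ParamPoly n N, substParams v (p + q) = substParams v p + substParams v q :=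
    fun p q => map_add _ p q
  have smul : ∀ p q : ParamPoly n N, substParams v (p * q) = substParams v p * substParams v q :=
    fun p q => map_mul _ p q
  have hX : ∀ s, substParams v (lieDeriv F (X s : ParamPoly n N)) =
      lieDerivation F (substParams v (X s)) := by
    intro s
    obtain ⟨s, rfl⟩ := toLex.surjective s
    rcases s with a | i
    · have h1 : lieDeriv F (X (toLex (Sum.inl a)) : ParamPoly n N) = 0 :=
        Finset.sum_eq_zero fun i _ => by
          rw [pderiv_X_of_ne (by simp), zero_mul]
      have h2 : substParams (N := N) v (X (toLex (Sum.inl a))) = C (v a) := by simp [substParams]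
      rw [h1, h2, ← algebraMap_eq, Derivation.map_algebraMap]
      exact map_zero _
    · have h1 : lieDeriv F (X (toLex (Sum.inr i)) : ParamPoly n N) = inclusion (F i) := by
        rw [lieDeriv, Finset.sum_eq_single i]
        · simp
        · intro j _ hj
          rw [pderiv_X_of_ne (by simpa using hj.symm), zero_mul]
        · simp
      have h2 : substParams (N := N) v (X (toLex (Sum.inr i))) = X i := by simp [substParams]
      rw [h1, h2, substParams_inclusion, lieDerivation, mkDerivation_X]
  induction π using MvPolynomial.induction_on with
  | C a =>
    have h1 : lieDeriv F (C a : ParamPoly n N) = 0 :=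
      Finset.sum_eq_zero fun i _ => by rw [pderiv_C, zero_mul]
    have h2 : substParams (n := n) (N := N) v (C a) = C a := by simp [substParams]
    rw [h1, h2, ← algebraMap_eq, Derivation.map_algebraMap]
    exact map_zero _
  | add p q hp hq => rw [hadd, sadd, hp, hq, sadd, map_add]
  | mul_X p s hp =>
    rw [hmul, sadd, smul, smul, smul, hp, hX, Derivation.leibniz]
    simp only [smul_eq_mul]
    ring

theorem substParams_iterLie (F : Fin N → MvPolynomial (Fin N) ℝ) (v : Fin n → ℝ) (j : ℕ)
    (π : ParamPoly n N) :
    substParams v (iterLie F j π) = (lieDerivation F)^[j] (substParams v π) := by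
  induction j with
  | zero => rfl
  | succ j ih =>
    rw [iterLie, Function.iterate_succ_apply', substParams_lieDeriv, ← iterLie, ih,
      Function.iterate_succ_apply']

theorem substParams_completeTemplate {k : ℕ}
    (e : Fin n ≃ {α : Fin N →₀ ℕ // α.degree ≤ k}) (v : Fin n → ℝ) :
    substParams v (completeTemplate e) = ∑ i, v i • monomial (e i : Fin N →₀ ℕ) (1 : ℝ) := by
  simp only [completeTemplate, substParams, map_sum, map_mul]
  refine Finset.sum_congr rfl fun i _ => ?_
  have := substParams_inclusion v (monomial (e i : Fin N →₀ ℕ) (1 : ℝ))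
  rw [substParams] at this
  rw [this, aeval_X, smul_eq_C_mul]
  simp

theorem exists_substParams_completeTemplate {k : ℕ}
    (e : Fin n ≃ {α : Fin N →₀ ℕ // α.degree ≤ k}) {p : MvPolynomial (Fin N) ℝ}
    (hp : p.totalDegree ≤ k) : ∃ v, substParams v (completeTemplate e) = p := by
  classical
  refine ⟨fun i => coeff (e i : Fin N →₀ ℕ) p, ?_⟩
  rw [substParams_completeTemplate]
  ext α
  rw [coeff_sum]
  simp only [coeff_smul, coeff_monomial, smul_eq_mul, mul_ite, mul_one, mul_zero]
  by_cases hα : α.degree ≤ k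
  · rw [Finset.sum_eq_single (e.symm ⟨α, hα⟩)]
    · simp
    · intro i _ hi
      rw [if_neg]
      rintro rfl
      simp at hi
    · simp
  · rw [Finset.sum_eq_zero]
    · symm
      by_contra h0
      refine hα (le_trans ?_ hp)
      exact le_totalDegree (mem_support_iff.2 h0)
    · intro i _
      rw [if_neg]
      rintro rfl
      exact hα (e i).2

end Specialization

/-! ### The double chain -/

section Chain

variable {n N : ℕ} {F : Fin N → MvPolynomial (Fin N) ℝ} {I : Ideal (MvPolynomial (Fin N) ℝ)}

/-- The Leibniz rule splits the derivative of `q * p` into two products, each with a factor (`p` or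
its derivative) that again satisfies `hp`; hence the induction generalizes both `p` and `q`. -/
theorem iterate_lieDerivation_mul_mem {p : MvPolynomial (Fin N) ℝ}
    (hp : ∀ j, (lieDerivation F)^[j] p ∈ I) (q : MvPolynomial (Fin N) ℝ) (j : ℕ) :
    (lieDerivation F)^[j] (q * p) ∈ I := by
  induction j generalizing p q with
  | zero => exact I.mul_mem_left q (hp 0)
  | succ j ih =>
    rw [Function.iterate_succ_apply, Derivation.leibniz, iterate_map_add]
    refine I.add_mem (ih (p := lieDerivation F p) (fun i => ?_) q) ?_
    · rw [← Function.iterate_succ_apply]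
      exact hp (i + 1)
    · rw [smul_eq_mul, mul_comm]
      exact ih hp _

/-- The ideal of the polynomials all of whose iterated Lie derivatives lie in `I`. -/
def invariantIdeal (F : Fin N → MvPolynomial (Fin N) ℝ) (I : Ideal (MvPolynomial (Fin N) ℝ)) :
    Ideal (MvPolynomial (Fin N) ℝ) where
  carrier := {p | ∀ j, (lieDerivation F)^[j] p ∈ I}
  zero_mem' j := by
    rw [iterate_map_zero]
    exact I.zero_mem
  add_mem' hp hq j := by
    rw [iterate_map_add]
    exact I.add_mem (hp j) (hq j)
  smul_mem' q _ hp j := iterate_lieDerivation_mul_mem hp q j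

theorem mem_invariantIdeal {p : MvPolynomial (Fin N) ℝ} :
    p ∈ invariantIdeal F I ↔ ∀ j, (lieDerivation F)^[j] p ∈ I :=
  Iff.rfl

variable {π : ParamPoly n N} {r : ℕ → ParamPoly n N}

theorem mem_valuationSet_iff
    (hr : ∀ j v, substParams v (r j) = 0 ↔ substParams v (iterLie F j π) ∈ I) {i : ℕ}
    {v : Fin n → ℝ} :
    v ∈ valuationSet r i ↔ ∀ j ≤ i, (lieDerivation F)^[j] (substParams v π) ∈ I := by
  simp only [valuationSet, Set.mem_ofPred_eq, hr, substParams_iterLie]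

theorem iterate_mem_chainIdeal {i j : ℕ} (hj : j ≤ i) {v : Fin n → ℝ} (hv : v ∈ valuationSet r i) :
    (lieDerivation F)^[j] (substParams v π) ∈ chainIdeal F π r i :=
  Ideal.subset_span ⟨j, hj, v, hv, (substParams_iterLie F v j π).symm⟩

theorem chainIdeal_le
    (hr : ∀ j v, substParams v (r j) = 0 ↔ substParams v (iterLie F j π) ∈ I) (i : ℕ) :
    chainIdeal F π r i ≤ I := by
  rw [chainIdeal, Ideal.span_le]
  rintro q ⟨j, hj, v, hv, rfl⟩
  exact (hr j v).1 (hv j hj)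

/-- Once both chains repeat, the ideal is stable under the Lie derivative. -/
theorem lieDerivation_mem_chainIdeal {m : ℕ} (hV : valuationSet r (m + 1) = valuationSet r m)
    (hJ : chainIdeal F π r (m + 1) = chainIdeal F π r m) {p : MvPolynomial (Fin N) ℝ}
    (hp : p ∈ chainIdeal F π r m) : lieDerivation F p ∈ chainIdeal F π r m := by
  rw [chainIdeal] at hp
  induction hp using Submodule.span_induction with
  | mem q hq =>
    obtain ⟨j, hj, v, hv, rfl⟩ := hq
    -- The derivative of a generator has index at most `m + 1` and its valuation lies in V_m =
    -- V_(m+1), so it is a generator of J_(m+1) = J_m.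
    rw [substParams_iterLie, ← Function.iterate_succ_apply' (lieDerivation F), ← hJ]
    exact iterate_mem_chainIdeal (Nat.succ_le_succ hj) (hV ▸ hv)
  | zero => simp
  | add p q _ _ hp hq =>
    rw [map_add]
    exact Ideal.add_mem _ hp hq
  | smul q p hp' hp =>
    rw [smul_eq_mul, Derivation.leibniz, smul_eq_mul, smul_eq_mul]
    exact Ideal.add_mem _ (Ideal.mul_mem_left _ _ hp) (Ideal.mul_mem_right _ _ hp')

theorem chainIdeal_le_invariantIdeal
    (hr : ∀ j v, substParams v (r j) = 0 ↔ substParams v (iterLie F j π) ∈ I) {m : ℕ}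
    (hV : valuationSet r (m + 1) = valuationSet r m)
    (hJ : chainIdeal F π r (m + 1) = chainIdeal F π r m) :
    chainIdeal F π r m ≤ invariantIdeal F I := by
  intro p hp j
  refine chainIdeal_le hr m ?_
  induction j with
  | zero => exact hp
  | succ j ih =>
    rw [Function.iterate_succ_apply']
    exact lieDerivation_mem_chainIdeal hV hJ ih

/-- The valuation of a generator of the invariant ideal survives in every V_m, and the index j = 0
already puts the generator into J_m. -/
theorem invariantIdeal_le_chainIdeal
    (hr : ∀ j v, substParams v (r j) = 0 ↔ substParams v (iterLie F j π) ∈ I)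
    {S : Set (MvPolynomial (Fin N) ℝ)} (hS : Ideal.span S = invariantIdeal F I)
    (hπ : ∀ p ∈ S, ∃ v, substParams v π = p) (m : ℕ) :
    invariantIdeal F I ≤ chainIdeal F π r m := by
  rw [← hS, Ideal.span_le]
  intro p hp
  obtain ⟨v, rfl⟩ := hπ p hp
  have hv : substParams v π ∈ invariantIdeal F I := hS ▸ Ideal.subset_span hp
  exact iterate_mem_chainIdeal (F := F) (Nat.zero_le m)
    ((mem_valuationSet_iff hr).2 fun j _ => hv j)

/-- Both chains repeat at some stage, if the template is linear in its parameters. -/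
theorem exists_stationary
    (hr : ∀ j v, substParams v (r j) = 0 ↔ substParams v (iterLie F j π) ∈ I)
    (T : (Fin n → ℝ) →ₗ[ℝ] MvPolynomial (Fin N) ℝ) (hT : ∀ v, substParams v π = T v) :
    ∃ m, valuationSet r (m + 1) = valuationSet r m ∧
      chainIdeal F π r (m + 1) = chainIdeal F π r m := by
  let W : ℕ →o (Submodule ℝ (Fin n → ℝ))ᵒᵈ :=
    { toFun := fun i => OrderDual.toDual
        { carrier := {v | ∀ j ≤ i, (lieDerivation F)^[j] (T v) ∈ I}
          zero_mem' := fun j _ => by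
            rw [map_zero, iterate_map_zero]
            exact I.zero_mem
          add_mem' := fun hv hw j hj => by
            rw [map_add, iterate_map_add]
            exact I.add_mem (hv j hj) (hw j hj)
          smul_mem' := fun c v hv j hj => by
            have : (lieDerivation F)^[j] (T (c • v)) = c • (lieDerivation F)^[j] (T v) := by
              rw [map_smul]
              exact (Function.Semiconj.iterate_right (f := fun p => c • p)
                (fun p => ((lieDerivation F).map_smul c p).symm) j _).symm
            rw [this, smul_eq_C_mul]
            exact I.mul_mem_left _ (hv j hj) }
      monotone' := fun i i' hi v hv j hj => hv j (hj.trans hi) }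
  have hW : ∀ i, valuationSet r i = (OrderDual.ofDual (W i) : Submodule ℝ (Fin n → ℝ)) := by
    intro i
    ext v
    rw [mem_valuationSet_iff hr, hT]
    rfl
  obtain ⟨i₀, hi₀⟩ := IsArtinian.monotone_stabilizes W
  have hV : ∀ i, valuationSet r (i₀ + i) = valuationSet r i₀ := by
    intro i
    rw [hW, hW, hi₀ (i₀ + i) (Nat.le_add_right _ _)]
  -- As V_i shrinks, J_i need not increase; it does from `i₀` on, where V_i is constant.
  obtain ⟨i₁, hi₁⟩ := monotone_stabilizes_iff_noetherian.2
    (inferInstance : IsNoetherianRing (MvPolynomial (Fin N) ℝ))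
    { toFun := fun i => chainIdeal F π r (i₀ + i)
      monotone' := fun i i' hi => Ideal.span_mono (by
        rintro q ⟨j, hj, v, hv, rfl⟩
        rw [hV] at hv
        exact ⟨j, hj.trans (by omega), v, (hV i').symm ▸ hv, rfl⟩) }
  refine ⟨i₀ + i₁, ?_, ?_⟩
  · rw [add_assoc, hV, hV]
  · exact (hi₁ (i₁ + 1) (Nat.le_succ _)).symm

end Chain

/-- On complete templates of large degree, the algorithm computes the ideal of the polynomials all
of whose Lie derivatives vanish on `ψ`. -/
theorem post_completeTemplate {N : ℕ} (F : Fin N → MvPolynomial (Fin N) ℝ)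
    (ψ : Set (Fin N → ℝ)) :
    ∃ K : ℕ, ∀ k ≥ K, ∀ (n : ℕ) (e : Fin n ≃ {α : Fin N →₀ ℕ // α.degree ≤ k}),
      (∃ V J, Post F ψ (completeTemplate e) V J) ∧
        ∀ V J, Post F ψ (completeTemplate e) V J →
          J = invariantIdeal F (vanishingIdeal ℝ ψ) := by
  obtain ⟨S, hS⟩ : (invariantIdeal F (vanishingIdeal ℝ ψ)).FG :=
    IsNoetherian.noetherian _
  -- K is the largest degree in a finite generating set, so the complete template realizes every
  -- generator.
  refine ⟨S.sup totalDegree, fun k hk n e => ⟨?_, ?_⟩⟩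
  · obtain ⟨G, hG⟩ := exists_isGroebnerBasis MonomialOrder.lex (vanishingIdeal ℝ ψ)
    classical
    choose r hr using fun j => exists_isRemainder MonomialOrder.lex
      (G.image (inclusion (n := n))) (iterLie F j (completeTemplate e))
    have hex := exists_stationary (F := F) (π := completeTemplate e)
      (fun j v => substParams_remainder_eq_zero_iff hG (by convert hr j) v)
      (∑ i, (LinearMap.proj i).smulRight (monomial (e i : Fin N →₀ ℕ) (1 : ℝ)))
      (fun v => by simp [substParams_completeTemplate])
    refine ⟨_, _, G, r, Nat.find hex, hG, fun j => by convert hr j, ⟨?_, ?_⟩, rfl, rfl⟩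
    · exact Nat.find_spec hex
    · exact fun i hi => Nat.find_min' hex hi
  · rintro V J ⟨G, r, m, hG, hr, ⟨⟨hmV, hmJ⟩, -⟩, -, rfl⟩
    have hr' := fun j v => substParams_remainder_eq_zero_iff hG (hr j) v
    refine le_antisymm (chainIdeal_le_invariantIdeal hr' hmV hmJ)
      (invariantIdeal_le_chainIdeal hr' hS (fun p hp => ?_) m)
    exact exists_substParams_completeTemplate e ((Finset.le_sup (f := totalDegree) hp).trans hk)

/-! ### Growth of iterated Lie derivatives -/

section Growth

variable {N : ℕ}

/-- The sum of the absolute values of the coefficients. -/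
def coeffNorm (p : MvPolynomial (Fin N) ℝ) : ℝ :=
  ∑ α ∈ p.support, |coeff α p|

theorem coeffNorm_nonneg (p : MvPolynomial (Fin N) ℝ) : 0 ≤ coeffNorm p :=
  Finset.sum_nonneg fun _ _ => abs_nonneg _

theorem coeffNorm_eq_sum {p : MvPolynomial (Fin N) ℝ} {S : Finset (Fin N →₀ ℕ)}
    (hS : p.support ⊆ S) : coeffNorm p = ∑ α ∈ S, |coeff α p| :=
  Finset.sum_subset hS fun α _ hα => by rw [notMem_support_iff.1 hα, abs_zero]

theorem coeffNorm_add_le (p q : MvPolynomial (Fin N) ℝ) :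
    coeffNorm (p + q) ≤ coeffNorm p + coeffNorm q := by
  classical
  rw [coeffNorm_eq_sum (support_add (p := p) (q := q)),
    coeffNorm_eq_sum (Finset.subset_union_left (s₁ := p.support) (s₂ := q.support)),
    coeffNorm_eq_sum (Finset.subset_union_right (s₁ := p.support) (s₂ := q.support)),
    ← Finset.sum_add_distrib]
  exact Finset.sum_le_sum fun α _ => by simpa only [coeff_add] using abs_add_le _ _

theorem coeffNorm_sum_le {ι : Type*} (s : Finset ι) (p : ι → MvPolynomial (Fin N) ℝ) :
    coeffNorm (∑ i ∈ s, p i) ≤ ∑ i ∈ s, coeffNorm (p i) :=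
  Finset.le_sum_of_subadditive _ (by simp [coeffNorm]) coeffNorm_add_le _ _

theorem coeffNorm_monomial (α : Fin N →₀ ℕ) (c : ℝ) : coeffNorm (monomial α c) = |c| := by
  rw [coeffNorm_eq_sum (support_monomial_subset (s := α) (a := c)), Finset.sum_singleton,
    coeff_monomial, if_pos rfl]

theorem coeffNorm_monomial_mul_le (α : Fin N →₀ ℕ) (c : ℝ) (q : MvPolynomial (Fin N) ℝ) :
    coeffNorm (monomial α c * q) ≤ |c| * coeffNorm q := by
  conv_lhs => rw [q.as_sum, Finset.mul_sum]
  refine (coeffNorm_sum_le _ _).trans (le_of_eq ?_)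
  rw [coeffNorm, Finset.mul_sum]
  exact Finset.sum_congr rfl fun β _ => by rw [monomial_mul, coeffNorm_monomial, abs_mul]

theorem abs_eval_le {R : ℝ} (hR : 1 ≤ R) {x : Fin N → ℝ} (hx : ∀ i, |x i| ≤ R)
    {p : MvPolynomial (Fin N) ℝ} {e : ℕ} (hp : p.totalDegree ≤ e) :
    |eval x p| ≤ coeffNorm p * R ^ e := by
  rw [eval_eq', coeffNorm, Finset.sum_mul]
  refine (Finset.abs_sum_le_sum_abs _ _).trans (Finset.sum_le_sum fun α hα => ?_)
  rw [abs_mul, Finset.abs_prod]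
  refine mul_le_mul_of_nonneg_left ?_ (abs_nonneg _)
  calc ∏ i, |x i ^ α i| ≤ ∏ i, R ^ α i :=
        Finset.prod_le_prod (fun _ _ => abs_nonneg _) fun i _ => by
          rw [abs_pow]
          exact pow_le_pow_left₀ (abs_nonneg _) (hx i) _
    _ = R ^ α.degree := by rw [Finset.prod_pow_eq_pow_sum, Finsupp.degree_eq_sum]
    _ ≤ R ^ e := pow_le_pow_right₀ hR ((le_totalDegree hα).trans hp)

variable (F : Fin N → MvPolynomial (Fin N) ℝ)

theorem lieDerivation_eq_sum (p : MvPolynomial (Fin N) ℝ) :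
    lieDerivation F p = ∑ α ∈ p.support, ∑ i,
      monomial (α - Finsupp.single i 1) (coeff α p * α i) * F i := by
  conv_lhs => rw [p.as_sum, map_sum]
  refine Finset.sum_congr rfl fun α _ => ?_
  rw [lieDerivation, mkDerivation_monomial, Finsupp.sum_fintype _ _ (by simp), Finset.smul_sum]
  refine Finset.sum_congr rfl fun i _ => ?_
  rw [smul_eq_mul, ← smul_mul_assoc, smul_monomial, smul_eq_mul]

theorem totalDegree_lieDerivation_le {d e : ℕ} (hF : ∀ i, (F i).totalDegree ≤ d)
    {p : MvPolynomial (Fin N) ℝ} (hp : p.totalDegree ≤ e) :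
    (lieDerivation F p).totalDegree ≤ e + d := by
  rw [lieDerivation_eq_sum]
  refine totalDegree_finsetSum_le fun α hα => totalDegree_finsetSum_le fun i _ => ?_
  refine (totalDegree_mul _ _).trans (add_le_add ?_ (hF i))
  refine (totalDegree_monomial_le _ _).trans (le_trans ?_ ((le_totalDegree hα).trans hp))
  exact Finsupp.degree_mono tsub_le_self

theorem coeffNorm_lieDerivation_le {e : ℕ} {p : MvPolynomial (Fin N) ℝ} (hp : p.totalDegree ≤ e) :
    coeffNorm (lieDerivation F p) ≤ e * (∑ i, coeffNorm (F i)) * coeffNorm p := by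
  rw [lieDerivation_eq_sum, coeffNorm.eq_1 p, Finset.mul_sum]
  refine (coeffNorm_sum_le _ _).trans (Finset.sum_le_sum fun α hα => ?_)
  rw [Finset.mul_sum, Finset.sum_mul]
  refine (coeffNorm_sum_le _ _).trans (Finset.sum_le_sum fun i _ => ?_)
  refine (coeffNorm_monomial_mul_le _ _ _).trans ?_
  have hi : (α i : ℝ) ≤ e := by
    exact_mod_cast (Finsupp.le_degree i α).trans ((le_totalDegree hα).trans hp)
  rw [abs_mul, Nat.abs_cast]
  have := mul_le_mul_of_nonneg_right hi
    (mul_nonneg (coeffNorm_nonneg (F i)) (abs_nonneg (coeff α p)))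
  linarith

/-- The degree grows by at most `d` per step, so step j multiplies the norm by at most (1 + j d) M ≤
(j + 1)(1 + d) M, with M the sum of the norms of the `F i`. The factors j + 1 build the factorial
that the Taylor coefficient cancels. -/
theorem growth_iterate_lieDerivation {d : ℕ} (hF : ∀ i, (F i).totalDegree ≤ d)
    {p : MvPolynomial (Fin N) ℝ} (hp : p.totalDegree ≤ 1) (j : ℕ) :
    ((lieDerivation F)^[j] p).totalDegree ≤ 1 + j * d ∧
      coeffNorm ((lieDerivation F)^[j] p) ≤
        j.factorial * ((1 + d) * ∑ i, coeffNorm (F i)) ^ j * coeffNorm p := by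
  induction j with
  | zero => simpa using hp
  | succ j ih =>
    obtain ⟨h1, h2⟩ := ih
    rw [Function.iterate_succ_apply']
    refine ⟨(totalDegree_lieDerivation_le F hF h1).trans (le_of_eq (by ring)), ?_⟩
    refine (coeffNorm_lieDerivation_le F h1).trans ?_
    set M := ∑ i, coeffNorm (F i)
    have hM : 0 ≤ M := Finset.sum_nonneg fun i _ => coeffNorm_nonneg _
    have h3 : ((1 + j * d : ℕ) : ℝ) ≤ (j + 1) * (1 + d) := by
      push_cast
      nlinarith [(Nat.cast_nonneg j : (0 : ℝ) ≤ j), (Nat.cast_nonneg d : (0 : ℝ) ≤ d)]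
    calc ((1 + j * d : ℕ) : ℝ) * M * coeffNorm ((lieDerivation F)^[j] p)
        ≤ ((j + 1) * (1 + d)) * M * (j.factorial * ((1 + d) * M) ^ j * coeffNorm p) :=
          mul_le_mul (mul_le_mul_of_nonneg_right h3 hM) h2 (coeffNorm_nonneg _) (by positivity)
      _ = (j + 1).factorial * ((1 + d) * M) ^ (j + 1) * coeffNorm p := by
          rw [Nat.factorial_succ]
          push_cast
          ring

/-- The Taylor coefficients of the solution grow at most geometrically. -/
theorem exists_abs_eval_iterate_le (x₀ : Fin N → ℝ) :
    ∃ C A : ℝ, 0 ≤ A ∧ ∀ i j,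
      |eval x₀ ((lieDerivation F)^[j] (X i)) / (j.factorial : ℝ)| ≤ C * A ^ j := by
  set d := Finset.univ.sup fun i => (F i).totalDegree
  have hF : ∀ i, (F i).totalDegree ≤ d := fun i =>
    Finset.le_sup (f := fun i => (F i).totalDegree) (Finset.mem_univ i)
  set R : ℝ := 1 + ∑ i, |x₀ i|
  have hR : 1 ≤ R := by
    have : 0 ≤ ∑ i, |x₀ i| := Finset.sum_nonneg fun _ _ => abs_nonneg _
    simp only [R]
    linarith
  have hx : ∀ i, |x₀ i| ≤ R := fun i => by
    have := Finset.single_le_sum (f := fun i => |x₀ i|) (fun _ _ => abs_nonneg _)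
      (Finset.mem_univ i)
    simp only [R]
    linarith
  have hM : 0 ≤ ∑ i, coeffNorm (F i) := Finset.sum_nonneg fun i _ => coeffNorm_nonneg _
  -- Evaluation in degree at most 1 + j d costs a factor R * (R ^ d) ^ j.
  refine ⟨R, ((1 + d) * ∑ i, coeffNorm (F i)) * R ^ d, by positivity, fun i j => ?_⟩
  obtain ⟨h1, h2⟩ := growth_iterate_lieDerivation F hF (totalDegree_X i).le j
  rw [abs_div, Nat.abs_cast, div_le_iff₀ (by positivity)]
  refine (abs_eval_le hR hx h1).trans ?_
  refine (mul_le_mul_of_nonneg_right h2 (by positivity)).trans (le_of_eq ?_)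
  rw [show coeffNorm (X i : MvPolynomial (Fin N) ℝ) = 1 from
    (coeffNorm_monomial _ _).trans abs_one, mul_pow _ (R ^ d), ← pow_mul, mul_comm d j, pow_add]
  ring

end Growth

/-! ### Taylor series -/

section Taylor

open scoped Topology ContDiff

/-- Summability at each ρ < r makes the terms there tend to 0, which bounds the radius of
convergence below by ρ. -/
theorem hasFPowerSeriesOnBall_tsum {c : ℕ → ℝ} {r : ℝ} (hr : 0 < r)
    (h : ∀ s : ℝ, |s| < r → Summable fun j => c j * s ^ j) :
    HasFPowerSeriesOnBall (fun t => ∑' j, c j * t ^ j)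
      (FormalMultilinearSeries.ofScalars ℝ c) 0 (ENNReal.ofReal r) where
  r_le := by
    refine ENNReal.le_of_forall_nnreal_lt fun ρ hρ => ?_
    have hρ' : (ρ : ℝ) < r := by
      rw [← ENNReal.ofReal_coe_nnreal] at hρ
      exact (ENNReal.ofReal_lt_ofReal_iff hr).1 hρ
    refine FormalMultilinearSeries.le_radius_of_tendsto _ (l := 0) ?_
    have := (h ρ (by simpa using hρ')).tendsto_atTop_zero.norm
    simpa [FormalMultilinearSeries.ofScalars_norm, abs_mul] using this
  r_pos := by simpa using hr
  hasSum := by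
    intro y hy
    have hy' : |y| < r := by
      rw [Metric.mem_eball, edist_dist, ENNReal.ofReal_lt_ofReal_iff hr] at hy
      simpa using hy
    simpa [FormalMultilinearSeries.ofScalars_apply_eq, mul_comm] using (h y hy').hasSum

theorem iteratedDeriv_tsum_div_factorial {c : ℕ → ℝ} {r : ℝ} (hr : 0 < r)
    (h : ∀ s : ℝ, |s| < r → Summable fun j => c j * s ^ j) (j : ℕ) :
    iteratedDeriv j (fun t => ∑' j, c j * t ^ j) 0 / (j.factorial : ℝ) = c j := by
  have h1 := (hasFPowerSeriesOnBall_tsum hr h).hasFPowerSeriesAt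
  have h2 := h1.analyticAt.hasFPowerSeriesAt
  exact congrFun (FormalMultilinearSeries.ofScalars_series_injective ℝ ℝ
    (h2.eq_formalMultilinearSeries h1)) j

theorem exists_hasSum_taylorTerm {f : ℝ → ℝ} (hf : AnalyticAt ℝ f 0) :
    ∃ ρ > 0, ∀ s : ℝ, |s| < ρ → HasSum (fun j => taylorTerm f j s) (f s) := by
  obtain ⟨r, hr⟩ := hf.hasFPowerSeriesAt
  obtain ⟨ρ, hρ0, hρ⟩ := ENNReal.lt_iff_exists_nnreal_btwn.1 hr.r_pos
  refine ⟨ρ, by simpa using hρ0, fun s hs => ?_⟩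
  have := hr.hasSum (y := s) (by
    refine Metric.eball_subset_eball hρ.le ?_
    rw [Metric.mem_eball, edist_dist, ← ENNReal.ofReal_coe_nnreal]
    refine (ENNReal.ofReal_lt_ofReal_iff ?_).2 (by simpa using hs)
    simpa using hρ0)
  simpa [FormalMultilinearSeries.ofScalars_apply_eq, taylorTerm, mul_comm] using this

/-- An analytic function near `0` is determined by its derivatives at `0`. -/
theorem eventually_eq_zero_of_iteratedDeriv {f : ℝ → ℝ} (hf : AnalyticAt ℝ f 0)
    (h : ∀ j, iteratedDeriv j f 0 = 0) : f =ᶠ[𝓝 0] 0 := by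
  obtain ⟨ρ, hρ, hs⟩ := exists_hasSum_taylorTerm hf
  filter_upwards [Metric.ball_mem_nhds (0 : ℝ) hρ] with s hs'
  have h1 := hs s (by simpa using hs')
  simp only [taylorTerm, h, zero_div, zero_mul] at h1
  exact h1.unique hasSum_zero

/-- Smooth curves with the same derivatives at `0` have the same derivatives at `0` after
composition with a polynomial. -/
theorem iteratedDeriv_eval_congr {N : ℕ} {x y : ℝ → Fin N → ℝ}
    (hx : ∀ i, ContDiffAt ℝ ∞ (fun t => x t i) 0) (hy : ∀ i, ContDiffAt ℝ ∞ (fun t => y t i) 0)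
    (h : ∀ i j, iteratedDeriv j (fun t => x t i) 0 = iteratedDeriv j (fun t => y t i) 0)
    (p : MvPolynomial (Fin N) ℝ) (j : ℕ) :
    iteratedDeriv j (fun t => eval (x t) p) 0 = iteratedDeriv j (fun t => eval (y t) p) 0 := by
  -- The induction carries smoothness along, since the product rule for higher derivatives needs it.
  have key : ContDiffAt ℝ ∞ (fun t => eval (x t) p) 0 ∧ ContDiffAt ℝ ∞ (fun t => eval (y t) p) 0 ∧
      ∀ j, iteratedDeriv j (fun t => eval (x t) p) 0 =
        iteratedDeriv j (fun t => eval (y t) p) 0 := by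
    induction p using MvPolynomial.induction_on with
    | C a =>
      simp only [eval_C]
      exact ⟨contDiffAt_const, contDiffAt_const, fun _ => trivial⟩
    | add p q hp hq =>
      obtain ⟨hp1, hp2, hp3⟩ := hp
      obtain ⟨hq1, hq2, hq3⟩ := hq
      simp only [map_add]
      refine ⟨hp1.add hq1, hp2.add hq2, fun j => ?_⟩
      have hj : ((j : ℕ∞) : WithTop ℕ∞) ≤ ∞ := by exact_mod_cast le_top
      rw [iteratedDeriv_fun_add (hp1.of_le hj) (hq1.of_le hj),
        iteratedDeriv_fun_add (hp2.of_le hj) (hq2.of_le hj), hp3, hq3]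
    | mul_X p i hp =>
      obtain ⟨hp1, hp2, hp3⟩ := hp
      simp only [map_mul, eval_X]
      refine ⟨hp1.mul (hx i), hp2.mul (hy i), fun j => ?_⟩
      have hj : ((j : ℕ∞) : WithTop ℕ∞) ≤ ∞ := by exact_mod_cast le_top
      rw [iteratedDeriv_fun_mul (hp1.of_le hj) ((hx i).of_le hj),
        iteratedDeriv_fun_mul (hp2.of_le hj) ((hy i).of_le hj)]
      simp only [hp3, h]
  exact key.2.2 j

end Taylor

/-! ### Solutions -/

section Solution

open scoped Topology ContDiff

variable {N : ℕ} {F : Fin N → MvPolynomial (Fin N) ℝ} {x₀ : Fin N → ℝ} {D : Set ℝ}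
  {x : ℝ → Fin N → ℝ}

theorem IsSolution.hasDerivAt_eval (h : IsSolution F x₀ D x) (p : MvPolynomial (Fin N) ℝ) {t : ℝ}
    (ht : t ∈ D) :
    HasDerivAt (fun t => eval (x t) p) (eval (x t) (lieDerivation F p)) t := by
  induction p using MvPolynomial.induction_on with
  | C a =>
    rw [← algebraMap_eq, Derivation.map_algebraMap]
    simpa using hasDerivAt_const t a
  | add p q hp hq => simpa only [map_add] using hp.fun_add hq
  | mul_X p i hp =>
    have hi : HasDerivAt (fun t => x t i) (eval (x t) (F i)) t :=
      hasDerivAt_pi.1 (h.2.2.2.2 t ht) i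
    simp only [map_mul, eval_X]
    refine (hp.fun_mul hi).congr_deriv ?_
    rw [Derivation.leibniz, lieDerivation, mkDerivation_X]
    simp only [map_add, smul_eq_mul, map_mul, eval_X]
    ring

theorem IsSolution.iteratedDeriv_eval (h : IsSolution F x₀ D x) (p : MvPolynomial (Fin N) ℝ)
    (j : ℕ) {t : ℝ} (ht : t ∈ D) :
    iteratedDeriv j (fun t => eval (x t) p) t = eval (x t) ((lieDerivation F)^[j] p) := by
  induction j generalizing t with
  | zero => simp
  | succ j ih =>
    have hloc : iteratedDeriv j (fun t => eval (x t) p) =ᶠ[𝓝 t]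
        fun t => eval (x t) ((lieDerivation F)^[j] p) := by
      filter_upwards [h.1.mem_nhds ht] with s hs using ih hs
    rw [iteratedDeriv_succ, hloc.deriv_eq, (h.hasDerivAt_eval _ ht).deriv,
      Function.iterate_succ_apply']

/-- Bootstrapping: the derivative is the same kind of function, with `p` replaced by its Lie
derivative. -/
theorem IsSolution.contDiffOn_eval (h : IsSolution F x₀ D x) (p : MvPolynomial (Fin N) ℝ) :
    ContDiffOn ℝ ∞ (fun t => eval (x t) p) D := by
  rw [contDiffOn_infty]
  intro n
  induction n generalizing p with
  | zero =>
    exact contDiffOn_zero.2 fun t ht => (h.hasDerivAt_eval p ht).continuousAt.continuousWithinAt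
  | succ n ih =>
    push_cast
    rw [contDiffOn_succ_iff_deriv_of_isOpen h.1]
    refine ⟨fun t ht => (h.hasDerivAt_eval p ht).differentiableAt.differentiableWithinAt,
      fun hn => by simp at hn, ?_⟩
    exact (ih (lieDerivation F p)).congr fun t ht => (h.hasDerivAt_eval p ht).deriv

variable (F x₀)

theorem exists_isSolution_localSolution : ∃ D, IsSolution F x₀ D (localSolution F x₀) :=
  Classical.choose_spec (exists_isSolution F x₀)

theorem iteratedDeriv_localSolution (i : Fin N) (j : ℕ) :
    iteratedDeriv j (fun t => localSolution F x₀ t i) 0 =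
      eval x₀ ((lieDerivation F)^[j] (X i)) := by
  obtain ⟨D, h⟩ := exists_isSolution_localSolution F x₀
  have := h.iteratedDeriv_eval (X i) j h.2.2.1
  rw [h.2.2.2.1] at this
  simpa only [eval_X] using this

/-- This makes the trajectory domain a neighbourhood of 0; were it empty, the safety assertion would
be vacuous at `x₀`. -/
theorem exists_summable_taylorTerm_localSolution :
    ∃ r > 0, ∀ s : ℝ, |s| < r → ∀ i : Fin N,
      Summable fun j => taylorTerm (fun s => localSolution F x₀ s i) j s := by
  obtain ⟨C, A, hA, h⟩ := exists_abs_eval_iterate_le F x₀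
  -- `A + 1` rather than `A`, because `A` may be 0.
  refine ⟨(A + 1)⁻¹, by positivity, fun s hs i => ?_⟩
  have hs1 : A * |s| < 1 := by
    calc A * |s| ≤ (A + 1) * |s| := mul_le_mul_of_nonneg_right (by linarith) (abs_nonneg s)
      _ < 1 := by rwa [← lt_inv_mul_iff₀ (by positivity), mul_one]
  refine Summable.of_norm_bounded (g := fun j => C * (A * |s|) ^ j)
    ((summable_geometric_of_lt_one (by positivity) hs1).mul_left C) fun j => ?_
  rw [taylorTerm, iteratedDeriv_localSolution, norm_mul, norm_pow, Real.norm_eq_abs,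
    Real.norm_eq_abs, mul_pow, ← mul_assoc]
  exact mul_le_mul_of_nonneg_right (h i j) (by positivity)

theorem exists_mem_trajectoryDomain : ∃ r > 0, ∀ s : ℝ, |s| < r → s ∈ trajectoryDomain F x₀ := by
  obtain ⟨r, hr, h⟩ := exists_summable_taylorTerm_localSolution F x₀
  exact ⟨r, hr, fun s hs => ⟨r, hs, h⟩⟩

variable {F x₀}

theorem analyticOnNhd_alongTrajectory {r : ℝ} (hr : 0 < r)
    (h : ∀ s : ℝ, |s| < r → ∀ i : Fin N,
      Summable fun j => taylorTerm (fun s => localSolution F x₀ s i) j s)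
    (p : MvPolynomial (Fin N) ℝ) :
    AnalyticOnNhd ℝ (alongTrajectory F x₀ p) (Metric.ball 0 r) := by
  have hi : ∀ i, AnalyticOnNhd ℝ (fun t => trajectory F x₀ t i) (Metric.ball 0 r) := by
    intro i
    have := (hasFPowerSeriesOnBall_tsum hr fun s hs => h s hs i).analyticOnNhd
    rw [Metric.eball_ofReal] at this
    exact this
  intro t ht
  exact AnalyticAt.aeval_mvPolynomial (fun i => hi i t ht) p

/-- The Taylor sum is never shown to equal the local solution: the two have the same derivatives at
0, polynomials preserve this, and the differential equation computes those of the local solution. -/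
theorem iteratedDeriv_alongTrajectory (p : MvPolynomial (Fin N) ℝ) (j : ℕ) :
    iteratedDeriv j (alongTrajectory F x₀ p) 0 = eval x₀ ((lieDerivation F)^[j] p) := by
  obtain ⟨r, hr, hsum⟩ := exists_summable_taylorTerm_localSolution F x₀
  obtain ⟨D, h⟩ := exists_isSolution_localSolution F x₀
  have hp := h.iteratedDeriv_eval p j h.2.2.1
  rw [h.2.2.2.1] at hp
  rw [← hp]
  refine iteratedDeriv_eval_congr (fun i => ?_) (fun i => ?_) (fun i j => ?_) p j
  · have := analyticOnNhd_alongTrajectory hr hsum (X i) 0 (Metric.mem_ball_self hr)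
    rw [show alongTrajectory F x₀ (X i) = fun t => trajectory F x₀ t i from
      funext fun t => eval_X i] at this
    exact this.contDiffAt
  · simpa only [eval_X] using (h.contDiffOn_eval (X i)).contDiffAt (h.1.mem_nhds h.2.2.1)
  · have := iteratedDeriv_tsum_div_factorial hr (fun s hs => hsum s hs i) j
    exact (div_left_inj' (by positivity)).1 this

theorem analyticAt_alongTrajectory (p : MvPolynomial (Fin N) ℝ) :
    AnalyticAt ℝ (alongTrajectory F x₀ p) 0 := by
  obtain ⟨r, hr, hsum⟩ := exists_summable_taylorTerm_localSolution F x₀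
  exact analyticOnNhd_alongTrajectory hr hsum p 0 (Metric.mem_ball_self hr)

/-- Vanishing derivatives give vanishing near 0; the identity theorem extends this to any ball on
which the Taylor series converge. -/
theorem alongTrajectory_eq_zero_iff (p : MvPolynomial (Fin N) ℝ) :
    (∀ t ∈ trajectoryDomain F x₀, alongTrajectory F x₀ p t = 0) ↔
      ∀ j, eval x₀ ((lieDerivation F)^[j] p) = 0 := by
  constructor
  · intro h j
    obtain ⟨r, hr, hD⟩ := exists_mem_trajectoryDomain F x₀
    have h0 : alongTrajectory F x₀ p =ᶠ[𝓝 0] fun _ => 0 := by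
      filter_upwards [Metric.ball_mem_nhds (0 : ℝ) hr] with t ht
      exact h t (hD t (by simpa using ht))
    rw [← iteratedDeriv_alongTrajectory, h0.iteratedDeriv_eq]
    simp
  · rintro h t ⟨r, htr, hsum⟩
    have hr : 0 < r := (abs_nonneg t).trans_lt htr
    have h0 := eventually_eq_zero_of_iteratedDeriv (analyticAt_alongTrajectory (F := F) (x₀ := x₀) p)
      fun j => (iteratedDeriv_alongTrajectory p j).trans (h j)
    exact (analyticOnNhd_alongTrajectory hr hsum p).eqOn_zero_of_preconnected_of_eventuallyEq_zero
      (convex_ball 0 r).isPreconnected (Metric.mem_ball_self hr) h0 (by simpa using htr)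

/-- Near 0 the behaviour sums to the analytic function it expands, so an invariant has zero
derivatives there. Conversely, all Taylor terms are 0. -/
theorem isPolynomialInvariant_iff (p : MvPolynomial (Fin N) ℝ) :
    IsPolynomialInvariant F x₀ p ↔ ∀ j, eval x₀ ((lieDerivation F)^[j] p) = 0 := by
  constructor
  · intro h j
    obtain ⟨ρ, hρ, hs⟩ := exists_hasSum_taylorTerm
      (analyticAt_alongTrajectory (F := F) (x₀ := x₀) p)
    have h0 : alongTrajectory F x₀ p =ᶠ[𝓝 0] fun _ => 0 := by
      filter_upwards [Metric.ball_mem_nhds (0 : ℝ) hρ] with t ht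
      have ht' : |t| < ρ := by simpa using ht
      rw [← (hs t ht').tsum_eq]
      exact h t ⟨ρ, ht', fun s hs' _ => (hs s hs').summable⟩
    rw [← iteratedDeriv_alongTrajectory, h0.iteratedDeriv_eq]
    simp
  · intro h t _
    simp [behaviour, taylorTerm, iteratedDeriv_alongTrajectory, h]

end Solution

/-- Trajectories from ψ stay in φ_ψ. Conversely, if `p` vanishes along them, its zero set is one of
the varieties being intersected. -/
theorem mem_strongestPostIdeal_iff {N : ℕ} {F : Fin N → MvPolynomial (Fin N) ℝ}
    {ψ : Set (Fin N → ℝ)} {p : MvPolynomial (Fin N) ℝ} :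
    p ∈ strongestPostIdeal F ψ ↔
      ∀ x₀ ∈ ψ, ∀ t ∈ trajectoryDomain F x₀, alongTrajectory F x₀ p t = 0 := by
  rw [strongestPostIdeal, mem_vanishingIdeal_iff]
  constructor
  · intro h x₀ hx₀ t ht
    refine h _ ?_
    rintro φ ⟨-, hφ⟩
    exact hφ x₀ hx₀ t ht
  · intro h x hx
    have := hx {x | eval x p = 0} ⟨⟨{p}, by simp⟩, h⟩
    exact this

theorem strongestPostIdeal_eq {N : ℕ} (F : Fin N → MvPolynomial (Fin N) ℝ) (ψ : Set (Fin N → ℝ)) :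
    strongestPostIdeal F ψ = invariantIdeal F (vanishingIdeal ℝ ψ) := by
  ext p
  simp only [mem_strongestPostIdeal_iff, alongTrajectory_eq_zero_iff, mem_invariantIdeal,
    mem_vanishingIdeal_iff]
  exact ⟨fun h j x hx => h x hx j, fun h x hx j => h j x hx⟩

end PolyODE

end

/-- For an algebraic variety `ψ`, the ideal `I_ψ` consists of the polynomials that are invariants
from every initial state in `ψ`, and for all sufficiently large `k` the algorithm run on the
complete template of degree `k` has an output `(V, J)`, and every such output has `J = I_ψ`. -/
theorem corollary2 (N : ℕ) (hN : 1 ≤ N) (F : Fin N → MvPolynomial (Fin N) ℝ)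
    (ψ : Set (Fin N → ℝ)) (hψ : PolyODE.IsAlgebraicVariety ψ) :
    (PolyODE.strongestPostIdeal F ψ : Set (MvPolynomial (Fin N) ℝ)) =
        {p | ∀ x₀ ∈ ψ, PolyODE.IsPolynomialInvariant F x₀ p} ∧
      ∃ K : ℕ, ∀ k ≥ K, ∀ (n : ℕ) (e : Fin n ≃ {α : Fin N →₀ ℕ // α.degree ≤ k}),
        (∃ (V : Set (Fin n → ℝ)) (J : Ideal (MvPolynomial (Fin N) ℝ)),
          PolyODE.Post F ψ (PolyODE.completeTemplate e) V J) ∧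
        ∀ (V : Set (Fin n → ℝ)) (J : Ideal (MvPolynomial (Fin N) ℝ)),
          PolyODE.Post F ψ (PolyODE.completeTemplate e) V J →
            J = PolyODE.strongestPostIdeal F ψ := by
  rw [PolyODE.strongestPostIdeal_eq]
  refine ⟨?_, PolyODE.post_completeTemplate F ψ⟩
  ext p
  simp only [SetLike.mem_coe, PolyODE.mem_invariantIdeal, MvPolynomial.mem_vanishingIdeal_iff,
    Set.mem_ofPred_eq, PolyODE.isPolynomialInvariant_iff]
  exact ⟨fun h x hx j => h j x hx, fun h j x hx => h x hx j⟩
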